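/- Let $(X,\lambda)$ be a standard $\sigma$-finite space, that is, an uncountable standard Borel space $X$ endowed with a nonzero atomless $\sigma$-finite Borel measure $\lambda$. Let $G$ be a locally compact Polish group, and let $\alpha$ be a boolean measure-preserving $G$-action on $(X,\lambda)$, i.e. a Borel map $\alpha: G\times X\to X$ such that (i) for all $g,h\in G$, we have $\alpha(gh,x)=\alpha(g,\alpha(h,x))$ for $\lambda$-almost every $x\in X$; (ii) for all $g\in G$, the map $\alpha(g,\cdot): X\to X$ is a bijection with $\lambda(\alpha(g,\cdot)^{-1}(A))=\lambda(A)$ for every Borel set $A\subseteq X$. Then $\alpha$ admits a continuous Radon model: there exist a locally compact Polish space $Y$, a Radon measure $\eta$ on $Y$ (a Borel measure that is finite on compact sets, inner regular with respect to compact sets on open sets, and outer regular on Borel sets) such that $(Y,\eta)$ is a standard $\sigma$-finite space, and a continuous action $\beta: G\times Y\to Y$ preserving $\eta$, such that $\alpha$ and $\beta$ are booleanly isomorphic. The latter means that there are a Borel set $X_0\subseteq X$ with $\lambda(X\setminus X_0)=0$ and an injective Borel map $\Phi: X_0\to Y$ with $\lambda(\Phi^{-1}(B))=\eta(B)$ for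 every Borel set $B\subseteq Y$, such that for every $g\in G$ there is a Borel set $X_g\subseteq X_0$ with $\lambda(X\setminus X_g)=0$, $\alpha(g,x)\in X_0$ and $\Phi(\alpha(g,x))=\beta(g,\Phi(x))$ for all $x\in X_g$. -/

import Mathlib

open MeasureTheory

universe u v

/-- A standard `σ`-finite space: an uncountable standard Borel space with a nontrivial atomless
`σ`-finite measure. (On a standard Borel space, a `σ`-finite measure is atomless if and only if
singletons are null, which is what `NullSingletonClass` says.) -/
structure IsStandardSigmaFinite {X : Type u} [MeasurableSpace X] (μ : Measure X) : Prop where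
  standardBorel : StandardBorelSpace X
  uncountable : Uncountable X
  sigmaFinite : SigmaFinite μ
  atomless : NullSingletonClass μ
  ne_zero : μ ≠ 0

/-- A boolean measure-preserving action of `G` on `(X, μ)`: a Borel map `G × X → X` such that every
`α g` is a measure-preserving bijection of `X`, and for all `g, h` the identity
`α (g * h) x = α g (α h x)` holds for almost every `x` (the null set may depend on `g, h`). -/
structure IsBooleanAction {G : Type v} {X : Type u} [Group G] [MeasurableSpace G]
    [MeasurableSpace X] (μ : Measure X) (α : G → X → X) : Prop where
  measurable : Measurable (fun p : G × X => α p.1 p.2)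
  mul_ae : ∀ g h : G, ∀ᵐ x ∂μ, α (g * h) x = α g (α h x)
  bijective : ∀ g : G, Function.Bijective (α g)
  measurePreserving : ∀ g : G, MeasurePreserving (α g) μ μ

/-- A boolean isomorphism between the actions `α` on `(X, μ)` and `β` on `(Y, ν)`: a
measure-preserving Borel injection `Φ : X₀ → Y` on a conull Borel set `X₀ ⊆ X` such that for each
`g` there is a conull Borel set `X_g ⊆ X₀` with `α g x ∈ X₀` and `Φ (α g x) = β g (Φ x)` for all
`x ∈ X_g`. Here `X₀` carries the restriction of `μ`. -/
structure IsBooleanIso {G : Type v} {X Y : Type u} [MeasurableSpace X] [MeasurableSpace Y]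
    (μ : Measure X) (ν : Measure Y) (α : G → X → X) (β : G → Y → Y)
    (X₀ : Set X) (Φ : X₀ → Y) : Prop where
  measurableSet : MeasurableSet X₀
  conull : μ X₀ᶜ = 0
  injective : Function.Injective Φ
  measurePreserving : MeasurePreserving Φ (μ.comap Subtype.val) ν
  equivariant : ∀ g : G, ∃ Xg : Set X, Xg ⊆ X₀ ∧ MeasurableSet Xg ∧ μ Xgᶜ = 0 ∧
    ∀ x ∈ Xg, ∃ (hx : x ∈ X₀) (hgx : α g x ∈ X₀), Φ ⟨α g x, hgx⟩ = β g (Φ ⟨x, hx⟩)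

/-- Two actions are booleanly isomorphic if there is a boolean isomorphism between them. -/
def BooleanlyIsomorphic {G : Type v} {X Y : Type u} [MeasurableSpace X] [MeasurableSpace Y]
    (μ : Measure X) (ν : Measure Y) (α : G → X → X) (β : G → Y → Y) : Prop :=
  ∃ (X₀ : Set X) (Φ : X₀ → Y), IsBooleanIso μ ν α β X₀ Φ

/-- `(Y, η)` with its `G`-action is a continuous Radon model of the boolean action `α` on `(X, μ)`:
`Y` is a locally compact Polish space with its Borel `σ`-algebra, `η` is a Radon measure making `Y`
a standard `σ`-finite space, the action of `G` on `Y` is (jointly) continuous and preserves `η`, and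
it is booleanly isomorphic to `α`. (`Measure.Regular` says: finite on compact sets, outer regular on
Borel sets, inner regular for compact sets on open sets.) -/
structure IsContinuousRadonModel {G : Type v} {X : Type u} [Group G] [TopologicalSpace G]
    [MeasurableSpace X] (μ : Measure X) (α : G → X → X)
    (Y : Type u) [TopologicalSpace Y] [MeasurableSpace Y] [MulAction G Y] (η : Measure Y) :
    Prop where
  polish : PolishSpace Y
  locallyCompact : LocallyCompactSpace Y
  borel : BorelSpace Y
  standard : IsStandardSigmaFinite η
  radon : η.Regular
  continuousSMul : ContinuousSMul G Y
  measurePreserving : ∀ g : G, MeasurePreserving (fun y : Y => g • y) η η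
  iso : BooleanlyIsomorphic μ η α (fun (g : G) (y : Y) => g • y)

/-!
Fix an injective `f ∈ L¹(μ)` with values in `(0, 1]`, and send `x` to its orbit function
`g ↦ f (α g⁻¹ x)`, a nonzero element of the unit ball of `L^∞(G) = L¹(G)*`. For the weak-* topology
this ball is a compact Polish space, on which `G` acts continuously by translation because
translation is norm-continuous on `L¹(G)`; without the origin it is still locally compact. Fubini's
theorem turns the identities valid almost everywhere for each group element into identities valid
for almost every point and almost every group element: the orbit map is therefore equivariant and
injective up to null sets. Fubini's theorem also shows that the coefficients
`x ↦ ∫ f (α g⁻¹ x) φ(g) dg`, for `φ ∈ L¹(G)`, are integrable. Hence the push-forward of `μ` is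
finite on the open sets `{ℓ | ε < |ℓ φ|}`. These cover the punctured ball, so the push-forward is
locally finite, hence Radon.
-/

open scoped ENNReal

theorem exists_measurable_injective_real (X : Type*) [MeasurableSpace X]
    [MeasurableSpace.CountablySeparated X] :
    ∃ e : X → ℝ, Measurable e ∧ Function.Injective e := by
  obtain ⟨i, hi, hinj⟩ :=
    MeasurableSpace.measurable_injection_nat_bool_of_countablySeparated X
  have hemb := measurableEmbedding_embeddingReal (ℕ → Bool)
  exact ⟨embeddingReal (ℕ → Bool) ∘ i, hemb.measurable.comp hi, hemb.injective.comp hinj⟩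

theorem measurableEq_of_countablySeparated (X : Type*) [MeasurableSpace X]
    [MeasurableSpace.CountablySeparated X] : MeasurableEq X := by
  obtain ⟨e, he, hinj⟩ := exists_measurable_injective_real X
  refine ⟨?_⟩
  simpa only [Set.diagonal, Function.comp_apply, hinj.eq_iff] using
    measurableSet_eq_fun (he.comp measurable_fst) (he.comp measurable_snd)

theorem exists_measurable_injective_pos_le {X : Type*} [MeasurableSpace X]
    [MeasurableSpace.CountablySeparated X] {w : X → ℝ} (hw : Measurable w) (hpos : ∀ x, 0 < w x) :
    ∃ f : X → ℝ, Measurable f ∧ Function.Injective f ∧ (∀ x, 0 < f x) ∧ ∀ x, f x ≤ w x := by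
  obtain ⟨e, he, hinj⟩ := exists_measurable_injective_real X
  -- The integer part of `(f x)⁻¹` bounds `f` by `w`, and its fractional part determines `x`.
  let n : X → ℕ := fun x => ⌈(w x)⁻¹⌉₊
  have hden : ∀ x, (w x)⁻¹ ≤ n x + (e x).sigmoid := fun x =>
    (Nat.le_ceil _).trans (le_add_of_nonneg_right (Real.sigmoid_nonneg _))
  have hfract : ∀ x, Int.fract (n x + (e x).sigmoid) = (e x).sigmoid := fun x => by
    rw [Int.fract_natCast_add]
    exact Int.fract_eq_self.2 ⟨Real.sigmoid_nonneg _, Real.sigmoid_lt_one _⟩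
  refine ⟨fun x => (n x + (e x).sigmoid)⁻¹, ?_, fun x y hxy => ?_,
    fun x => inv_pos.2 ((inv_pos.2 (hpos x)).trans_le (hden x)),
    fun x => inv_le_of_inv_le₀ (hpos x) (hden x)⟩
  · have hn : Measurable n := Nat.measurable_ceil.comp hw.inv
    exact ((measurable_from_nat.comp hn).add (continuous_sigmoid.measurable.comp he)).inv
  · have h := congrArg Int.fract (inv_injective hxy)
    rw [hfract, hfract] at h
    exact hinj (Real.sigmoid_injective h)

theorem exists_measurable_injective_pos_le_one_integrable {X : Type*} [MeasurableSpace X]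
    [MeasurableSpace.CountablySeparated X] (μ : Measure X) [SigmaFinite μ] :
    ∃ f : X → ℝ, Measurable f ∧ Function.Injective f ∧ (∀ x, 0 < f x) ∧ (∀ x, f x ≤ 1) ∧
      Integrable f μ := by
  obtain ⟨w, hwpos, hw, hwint⟩ := exists_pos_lintegral_lt_of_sigmaFinite μ one_ne_zero
  have hwint' : Integrable (fun x => (w x : ℝ)) μ := by
    refine ⟨hw.coe_nnreal_real.aestronglyMeasurable, ?_⟩
    simpa [HasFiniteIntegral] using hwint.trans ENNReal.one_lt_top
  obtain ⟨f, hf, hinj, hpos, hle⟩ := exists_measurable_injective_pos_le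
    (hw.coe_nnreal_real.min measurable_const) fun x => lt_min (hwpos x) one_pos
  refine ⟨f, hf, hinj, hpos, fun x => (hle x).trans (min_le_right _ _),
    hwint'.mono' hf.aestronglyMeasurable (.of_forall fun x => ?_)⟩
  rw [Real.norm_of_nonneg (hpos x).le]
  exact (hle x).trans (min_le_left _ _)

section Shrink

theorem small_of_standardBorelSpace (Z : Type*) [MeasurableSpace Z] [StandardBorelSpace Z] :
    Small.{u} Z :=
  small_of_injective (measurableEmbedding_embeddingReal Z).injective

variable (Z : Type*) [TopologicalSpace Z] [Small.{u} Z]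

theorem polishSpace_shrink [PolishSpace Z] : PolishSpace (Shrink.{u} Z) :=
  (Shrink.homeomorph Z).symm.isClosedEmbedding.polishSpace

theorem locallyCompactSpace_shrink [LocallyCompactSpace Z] :
    LocallyCompactSpace (Shrink.{u} Z) :=
  (Shrink.homeomorph Z).symm.isClosedEmbedding.locallyCompactSpace

theorem continuousSMul_shrink (G : Type*) [Monoid G] [TopologicalSpace G] [MulAction G Z]
    [ContinuousSMul G Z] : ContinuousSMul G (Shrink.{u} Z) :=
  ⟨(Shrink.homeomorph Z).continuous.comp
    (continuous_fst.smul ((Shrink.homeomorph Z).symm.continuous.comp continuous_snd))⟩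

end Shrink

theorem norm_smul_of_isIsometricSMul {M F : Type*} [Monoid M] [NormedAddCommGroup F]
    [DistribMulAction M F] [IsIsometricSMul M F] (c : M) (φ : F) : ‖c • φ‖ = ‖φ‖ := by
  simpa using dist_smul c φ 0

section DualBall

variable (𝕜 E : Type*) [NontriviallyNormedField 𝕜] [NormedAddCommGroup E] [NormedSpace 𝕜 E]

/-- The closed unit ball of the dual of `E`, with the weak-* topology. -/
abbrev DualBall : Type _ :=
  WeakDual.toStrongDual ⁻¹' Metric.closedBall (0 : StrongDual 𝕜 E) 1

/-- The nonzero elements of the closed unit ball of the dual of `E`, with the weak-* topology. The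
origin is removed so that every point has a neighborhood on which some evaluation map is bounded
away from zero. -/
def PuncturedDualBall : Type _ := {ℓ : DualBall 𝕜 E // ℓ.1 ≠ 0}

variable {𝕜 E}

namespace DualBall

theorem norm_apply_le (ℓ : DualBall 𝕜 E) (φ : E) : ‖ℓ.1 φ‖ ≤ ‖φ‖ := by
  simpa using ContinuousLinearMap.le_of_opNorm_le _ (mem_closedBall_zero_iff.1 ℓ.2) φ

instance [ProperSpace 𝕜] : CompactSpace (DualBall 𝕜 E) :=
  isCompact_iff_compactSpace.1 (WeakDual.isCompact_closedBall 0 1)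

theorem continuous_apply (φ : E) : Continuous fun ℓ : DualBall 𝕜 E => ℓ.1 φ :=
  (WeakDual.eval_continuous φ).comp continuous_subtype_val

theorem lipschitzWith_one (ℓ : DualBall 𝕜 E) : LipschitzWith 1 ℓ.1 :=
  LipschitzWith.of_dist_le_mul fun φ ψ => by
    simpa [dist_eq_norm, map_sub] using ℓ.norm_apply_le (φ - ψ)

theorem continuous_eval : Continuous fun p : DualBall 𝕜 E × E => p.1.1 p.2 :=
  continuous_prod_of_continuous_lipschitzWith' _ 1 lipschitzWith_one continuous_apply

theorem isClosedEmbedding_eval_denseSeq [ProperSpace 𝕜] [TopologicalSpace.SeparableSpace E] :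
    Topology.IsClosedEmbedding
      fun (ℓ : DualBall 𝕜 E) (n : ℕ) => ℓ.1 (TopologicalSpace.denseSeq E n) := by
  refine (continuous_pi fun n => continuous_apply _).isClosedEmbedding fun ℓ ℓ' h => ?_
  exact Subtype.ext (DFunLike.coe_injective
    ((TopologicalSpace.denseRange_denseSeq E).equalizer ℓ.1.continuous ℓ'.1.continuous h))

instance [ProperSpace 𝕜] [TopologicalSpace.SeparableSpace E] : PolishSpace (DualBall 𝕜 E) :=
  isClosedEmbedding_eval_denseSeq.polishSpace

end DualBall

namespace PuncturedDualBall

noncomputable instance : TopologicalSpace (PuncturedDualBall 𝕜 E) := instTopologicalSpaceSubtype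

noncomputable instance : FunLike (PuncturedDualBall 𝕜 E) E 𝕜 where
  coe ℓ := ℓ.1.1
  coe_injective := DFunLike.coe_injective.comp
    (Subtype.val_injective.comp Subtype.val_injective)

theorem isOpen_setOf_ne_zero : IsOpen {ℓ : DualBall 𝕜 E | ℓ.1 ≠ 0} :=
  isOpen_ne.preimage continuous_subtype_val

instance [ProperSpace 𝕜] : LocallyCompactSpace (PuncturedDualBall 𝕜 E) :=
  isOpen_setOf_ne_zero.isLocallyClosed.locallyCompactSpace

instance [ProperSpace 𝕜] [TopologicalSpace.SeparableSpace E] :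
    PolishSpace (PuncturedDualBall 𝕜 E) :=
  isOpen_setOf_ne_zero.polishSpace

theorem exists_apply_ne_zero (ℓ : PuncturedDualBall 𝕜 E) : ∃ φ, ℓ φ ≠ 0 := by
  by_contra! h
  exact ℓ.2 (DFunLike.ext _ _ h)

theorem continuous_apply (φ : E) : Continuous fun ℓ : PuncturedDualBall 𝕜 E => ℓ φ :=
  (DualBall.continuous_apply φ).comp continuous_subtype_val

theorem continuous_iff {T : Type*} [TopologicalSpace T] {F : T → PuncturedDualBall 𝕜 E} :
    Continuous F ↔ ∀ φ, Continuous fun t => F t φ :=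
  ⟨fun h φ => (continuous_apply φ).comp h, fun h =>
    ((WeakDual.continuous_of_continuous_eval h).subtype_mk _).subtype_mk _⟩

theorem measurable_iff [ProperSpace 𝕜] [TopologicalSpace.SeparableSpace E]
    [MeasurableSpace 𝕜] [BorelSpace 𝕜] [MeasurableSpace (PuncturedDualBall 𝕜 E)]
    [BorelSpace (PuncturedDualBall 𝕜 E)] {X : Type*} [MeasurableSpace X]
    {Φ : X → PuncturedDualBall 𝕜 E} : Measurable Φ ↔ ∀ φ, Measurable fun x => Φ x φ := by
  have hemb : Topology.IsEmbedding fun (ℓ : PuncturedDualBall 𝕜 E) (n : ℕ) =>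
      ℓ (TopologicalSpace.denseSeq E n) :=
    DualBall.isClosedEmbedding_eval_denseSeq.isEmbedding.comp .subtypeVal
  refine ⟨fun h φ => (continuous_apply φ).measurable.comp h, fun h => ?_⟩
  rw [← (hemb.continuous.measurableEmbedding hemb.injective).measurable_comp_iff]
  exact measurable_pi_lambda _ fun n => h _

theorem isLocallyFiniteMeasure_of_integrable [MeasurableSpace (PuncturedDualBall 𝕜 E)]
    {ν : Measure (PuncturedDualBall 𝕜 E)}
    (h : ∀ φ, Integrable (fun ℓ : PuncturedDualBall 𝕜 E => ℓ φ) ν) :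
    IsLocallyFiniteMeasure ν where
  finiteAtNhds ℓ := by
    obtain ⟨φ, hφ⟩ := ℓ.exists_apply_ne_zero
    have hpos : 0 < ‖ℓ φ‖ / 2 := half_pos (norm_pos_iff.2 hφ)
    have hopen : IsOpen {ℓ' : PuncturedDualBall 𝕜 E | ‖ℓ φ‖ / 2 < ‖ℓ' φ‖} :=
      isOpen_lt continuous_const (continuous_apply φ).norm
    refine ⟨_, hopen.mem_nhds (half_lt_self (norm_pos_iff.2 hφ)), ?_⟩
    refine lt_of_le_of_lt (measure_mono ?_) ((h φ).measure_norm_ge_lt_top hpos)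
    exact fun ℓ' (hℓ' : ‖ℓ φ‖ / 2 < ‖ℓ' φ‖) => hℓ'.le

section Action

variable {G : Type*} [Group G] [DistribMulAction Gᵈᵐᵃ E] [SMulCommClass Gᵈᵐᵃ 𝕜 E]
  [IsIsometricSMul Gᵈᵐᵃ E]

/-- The functional `φ ↦ ℓ (c • φ)`. -/
noncomputable def precompSMul (c : Gᵈᵐᵃ) (ℓ : PuncturedDualBall 𝕜 E) : PuncturedDualBall 𝕜 E :=
  ⟨⟨StrongDual.toWeakDual ((WeakDual.toStrongDual ℓ.1.1).comp
      { toLinearMap := DistribSMul.toLinearMap 𝕜 E c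
        cont := (isometry_smul E c).continuous }),
    mem_closedBall_zero_iff.2 <| ContinuousLinearMap.opNorm_le_bound _ zero_le_one fun φ => by
      rw [one_mul]
      exact (ℓ.1.norm_apply_le (c • φ)).trans_eq (norm_smul_of_isIsometricSMul c φ)⟩, fun h => by
    obtain ⟨φ, hφ⟩ := ℓ.exists_apply_ne_zero
    have := DFunLike.congr_fun h (c⁻¹ • φ)
    change ℓ (c • c⁻¹ • φ) = 0 at this
    exact hφ (by rwa [smul_inv_smul] at this)⟩

/-- Precomposition is a left action of `G`, since `Gᵈᵐᵃ` is the opposite group of `G`. -/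
noncomputable instance : MulAction G (PuncturedDualBall 𝕜 E) where
  smul g ℓ := precompSMul (DomMulAct.mk g) ℓ
  one_smul ℓ := DFunLike.ext _ _ fun φ => congrArg ℓ (one_smul Gᵈᵐᵃ φ)
  mul_smul g h ℓ := DFunLike.ext _ _ fun φ =>
    congrArg ℓ (mul_smul (DomMulAct.mk h) (DomMulAct.mk g) φ)

instance [TopologicalSpace G] [ContinuousSMul Gᵈᵐᵃ E] :
    ContinuousSMul G (PuncturedDualBall 𝕜 E) where
  continuous_smul := continuous_iff.2 fun _ =>
    DualBall.continuous_eval.comp ((continuous_subtype_val.comp continuous_snd).prodMk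
      ((DomMulAct.continuous_mk.comp continuous_fst).smul continuous_const))

end Action
end PuncturedDualBall
end DualBall

section LInfty

variable {𝕜 Ω : Type*} [RCLike 𝕜] [MeasurableSpace Ω] {m : Measure Ω}

/-- The functional `φ ↦ ∫ F φ` on `L¹(m)` attached to `F ∈ L^∞(m)`. -/
noncomputable def integralDual (F : Lp 𝕜 ∞ m) : StrongDual 𝕜 (Lp 𝕜 1 m) :=
  (ContinuousLinearMap.mul 𝕜 𝕜).lpPairing m ∞ 1 F

theorem integralDual_apply (F : Lp 𝕜 ∞ m) (φ : Lp 𝕜 1 m) :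
    integralDual F φ = ∫ ω, F ω * φ ω ∂m :=
  ContinuousLinearMap.lpPairing_eq_integral _ F φ

theorem integralDual_sub (F F' : Lp 𝕜 ∞ m) :
    integralDual (F - F') = integralDual F - integralDual F' :=
  map_sub _ F F'

theorem norm_integralDual_le (F : Lp 𝕜 ∞ m) : ‖integralDual F‖ ≤ ‖F‖ := by
  refine ContinuousLinearMap.opNorm_le_bound _ (norm_nonneg F) fun φ => ?_
  calc ‖integralDual F φ‖
      ≤ ‖(ContinuousLinearMap.mul 𝕜 𝕜).holder 1 F φ‖ :=
      (congrArg norm (L1.integral_eq' 𝕜 _).symm).trans_le (L1.norm_integral_le _)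
    _ ≤ ‖ContinuousLinearMap.mul 𝕜 𝕜‖ * ‖F‖ * ‖φ‖ :=
      ContinuousLinearMap.norm_holder_apply_apply_le _ F φ
    _ = ‖F‖ * ‖φ‖ := by rw [ContinuousLinearMap.opNorm_mul, one_mul]

theorem integralDual_indicatorConstLp_one (F : Lp 𝕜 ∞ m) {s : Set Ω} (hs : MeasurableSet s)
    (hms : m s ≠ ∞) : integralDual F (indicatorConstLp 1 hs hms 1) = ∫ ω in s, F ω ∂m := by
  rw [integralDual_apply, ← integral_indicator hs]
  refine integral_congr_ae ?_
  filter_upwards [indicatorConstLp_coeFn (p := 1) (hs := hs) (hμs := hms) (c := (1 : 𝕜))]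
    with ω hω
  rw [hω]
  by_cases hωs : ω ∈ s <;> simp [hωs]

theorem integralDual_injective [SigmaFinite m] :
    Function.Injective (integralDual : Lp 𝕜 ∞ m → StrongDual 𝕜 (Lp 𝕜 1 m)) := by
  suffices h : ∀ F : Lp 𝕜 ∞ m, integralDual F = 0 → F = 0 from fun F F' hFF' =>
    sub_eq_zero.1 (h _ (by rw [integralDual_sub, hFF', sub_self]))
  intro F hF
  refine (Lp.eq_zero_iff_ae_eq_zero).2 (ae_eq_zero_of_forall_setIntegral_eq_of_sigmaFinite
    (fun s _ hms => integrableOn_Lp_of_measure_ne_top F le_top hms.ne) fun s hs hms => ?_)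
  rw [← integralDual_indicatorConstLp_one F hs hms.ne, hF, zero_apply]

theorem integralDual_smul_smul {M : Type*} [Group M] [MulAction M Ω] [MeasurableConstSMul M Ω]
    [SMulInvariantMeasure M Ω m] (c : Mᵈᵐᵃ) (F : Lp 𝕜 ∞ m) (φ : Lp 𝕜 1 m) :
    integralDual (c • F) (c • φ) = integralDual F φ := by
  rw [integralDual_apply, integralDual_apply,
    ← (measurePreserving_smul (DomMulAct.mk.symm c) m).integral_comp
      (measurableEmbedding_const_smul _) fun ω => F ω * φ ω]
  refine integral_congr_ae ?_
  filter_upwards [DomMulAct.smul_Lp_ae_eq c F, DomMulAct.smul_Lp_ae_eq c φ] with ω hF hφ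
  rw [hF, hφ]

namespace PuncturedDualBall

variable [SigmaFinite m]

/-- The functional `φ ↦ ∫ F φ` attached to a nonzero `F` in the unit ball of `L^∞(m)`. -/
noncomputable def ofLInfty (F : Lp 𝕜 ∞ m) (hF : ‖F‖ ≤ 1) (hF₀ : F ≠ 0) :
    PuncturedDualBall 𝕜 (Lp 𝕜 1 m) :=
  ⟨⟨StrongDual.toWeakDual (integralDual F),
    mem_closedBall_zero_iff.2 ((norm_integralDual_le F).trans hF)⟩,
    fun h => hF₀ (integralDual_injective (h.trans (map_zero _).symm))⟩

theorem ofLInfty_inj {F F' : Lp 𝕜 ∞ m} {hF : ‖F‖ ≤ 1} {hF₀ : F ≠ 0} {hF' : ‖F'‖ ≤ 1}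
    {hF'₀ : F' ≠ 0} : ofLInfty F hF hF₀ = ofLInfty F' hF' hF'₀ ↔ F = F' := by
  refine ⟨fun h => integralDual_injective (DFunLike.ext _ _ fun φ => ?_), fun h => by subst h; rfl⟩
  exact DFunLike.congr_fun h φ

end PuncturedDualBall
end LInfty

/-- A near action of `G` on `(X, μ)`: a measurable map `G × X → X` satisfying the axioms of a
measure-preserving action up to null sets. This is a boolean action whose maps `α g` need not be
bijective. -/
structure IsNearAction {G X : Type*} [Group G] [MeasurableSpace G] [MeasurableSpace X]
    (μ : Measure X) (α : G → X → X) : Prop where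
  measurable : Measurable fun p : G × X => α p.1 p.2
  mul_ae : ∀ g h : G, ∀ᵐ x ∂μ, α (g * h) x = α g (α h x)
  measurePreserving : ∀ g : G, MeasurePreserving (α g) μ μ

theorem IsBooleanAction.isNearAction {G X : Type*} [Group G] [MeasurableSpace G]
    [MeasurableSpace X] {μ : Measure X} {α : G → X → X} (hα : IsBooleanAction μ α) :
    IsNearAction μ α :=
  ⟨hα.measurable, hα.mul_ae, hα.measurePreserving⟩

namespace IsNearAction

variable {G X : Type*} [Group G] [MeasurableSpace G] [MeasurableSpace X] {μ : Measure X}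
  {α : G → X → X}

theorem one_ae [MeasurableEq X] (hα : IsNearAction μ α) : ∀ᵐ x ∂μ, α 1 x = x := by
  have h₁ := hα.measurePreserving 1
  have hfix : ∀ᵐ y ∂μ.map (α 1), α 1 y = y := by
    refine (ae_map_iff h₁.aemeasurable (measurableSet_eq_fun h₁.measurable measurable_id)).2 ?_
    filter_upwards [hα.mul_ae 1 1] with x hx
    rw [id, ← hx, mul_one]
  rwa [h₁.map_eq] at hfix

theorem inv_right_ae [MeasurableEq X] (hα : IsNearAction μ α) (g : G) :
    ∀ᵐ x ∂μ, α g (α g⁻¹ x) = x := by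
  filter_upwards [hα.mul_ae g g⁻¹, hα.one_ae] with x hmul hone
  rw [← hmul, mul_inv_cancel, hone]

variable [MeasurableInv G]

theorem measurable_inv_apply (hα : IsNearAction μ α) :
    Measurable fun p : G × X => α p.1⁻¹ p.2 :=
  hα.measurable.comp (measurable_fst.inv.prodMk measurable_snd)

variable (m : Measure G) [SFinite m]

theorem measurable_matrixCoefficient {𝕜 : Type*} [RCLike 𝕜] (hα : IsNearAction μ α) {f : X → 𝕜}
    (hf : Measurable f) {φ : G → 𝕜} (hφ : Measurable φ) :
    Measurable fun x => ∫ g, f (α g⁻¹ x) * φ g ∂m :=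
  (StronglyMeasurable.integral_prod_left' ((hf.comp hα.measurable_inv_apply).mul
    (hφ.comp measurable_fst)).stronglyMeasurable).measurable

variable [SFinite μ]

theorem ae_ae_inv_right [MeasurableEq X] (hα : IsNearAction μ α) :
    ∀ᵐ x ∂μ, ∀ᵐ g ∂m, α g (α g⁻¹ x) = x := by
  refine (Measure.ae_ae_comm (p := fun g x => α g (α g⁻¹ x) = x) ?_).1
    (.of_forall hα.inv_right_ae)
  exact measurableSet_eq_fun (hα.measurable.comp
    (measurable_fst.prodMk hα.measurable_inv_apply)) measurable_snd

theorem ae_ae_orbit_eq [MeasurableMul G] {E : Type*} [MeasurableSpace E] [MeasurableEq E]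
    (hα : IsNearAction μ α) {f : X → E} (hf : Measurable f) (h : G) :
    ∀ᵐ x ∂μ, ∀ᵐ g ∂m, f (α g⁻¹ (α h x)) = f (α (h⁻¹ * g)⁻¹ x) := by
  refine (Measure.ae_ae_comm (p := fun g x => f (α g⁻¹ (α h x)) = f (α (h⁻¹ * g)⁻¹ x))
    (measurableSet_eq_fun ?_ ?_)).1 (.of_forall fun g => ?_)
  · exact hf.comp (hα.measurable_inv_apply.comp
      (measurable_fst.prodMk ((hα.measurePreserving h).measurable.comp measurable_snd)))
  · exact hf.comp (hα.measurable_inv_apply.comp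
      ((measurable_fst.const_mul h⁻¹).prodMk measurable_snd))
  · filter_upwards [hα.mul_ae g⁻¹ h] with x hx
    rw [mul_inv_rev, inv_inv, hx]

theorem measurePreserving_shear (hα : IsNearAction μ α) :
    MeasurePreserving (fun p : G × X => (p.1, α p.1⁻¹ p.2)) (m.prod μ) (m.prod μ) :=
  (MeasurePreserving.id m).skew_product (g := fun g x => α g⁻¹ x) hα.measurable_inv_apply
    (.of_forall fun g => (hα.measurePreserving g⁻¹).map_eq)

theorem integrable_matrixCoefficient {𝕜 : Type*} [RCLike 𝕜] (hα : IsNearAction μ α) {f : X → 𝕜}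
    (hf : Integrable f μ) {φ : G → 𝕜} (hφ : Integrable φ m) :
    Integrable (fun x => ∫ g, f (α g⁻¹ x) * φ g ∂m) μ := by
  simp only [mul_comm (f _)]
  exact ((hα.measurePreserving_shear m).integrable_comp_of_integrable
    (hφ.mul_prod hf)).integral_prod_right

end IsNearAction

namespace IsNearAction

variable {𝕜 G X : Type*} [RCLike 𝕜] [Group G] [MeasurableSpace G] [MeasurableInv G]
  [MeasurableSpace X] {μ : Measure X} {α : G → X → X} {f : X → 𝕜}

theorem memLp_top_orbit (hα : IsNearAction μ α) (m : Measure G) (hf : Measurable f)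
    (hf₁ : ∀ x, ‖f x‖ ≤ 1) (x : X) : MemLp (fun g => f (α g⁻¹ x)) ∞ m :=
  memLp_top_of_bound
    (hf.comp (hα.measurable_inv_apply.comp measurable_prodMk_right)).aestronglyMeasurable 1
    (.of_forall fun _ => hf₁ _)

/-- The orbit function `g ↦ f (α g⁻¹ x)` of the point `x`, as an element of `L^∞(m)`. -/
noncomputable def orbitLInfty (hα : IsNearAction μ α) (m : Measure G) (hf : Measurable f)
    (hf₁ : ∀ x, ‖f x‖ ≤ 1) (x : X) : Lp 𝕜 ∞ m :=
  (hα.memLp_top_orbit m hf hf₁ x).toLp _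

variable {m : Measure G} {hf : Measurable f} {hf₁ : ∀ x, ‖f x‖ ≤ 1}

theorem coeFn_orbitLInfty (hα : IsNearAction μ α) (x : X) :
    hα.orbitLInfty m hf hf₁ x =ᵐ[m] fun g => f (α g⁻¹ x) :=
  MemLp.coeFn_toLp _

theorem norm_orbitLInfty_le (hα : IsNearAction μ α) (x : X) :
    ‖hα.orbitLInfty m hf hf₁ x‖ ≤ 1 := by
  rw [orbitLInfty, Lp.norm_toLp, eLpNorm_exponent_top]
  exact ENNReal.toReal_le_of_le_ofReal zero_le_one
    (eLpNormEssSup_le_of_ae_bound (.of_forall fun _ => hf₁ _))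

theorem orbitLInfty_ne_zero [NeZero m] (hα : IsNearAction μ α) (hf₀ : ∀ x, f x ≠ 0) (x : X) :
    hα.orbitLInfty m hf hf₁ x ≠ 0 := fun h => by
  obtain ⟨g, hg⟩ :=
    ((hα.coeFn_orbitLInfty x).symm.trans (Lp.eq_zero_iff_ae_eq_zero.1 h)).exists
  exact hf₀ _ hg

theorem ae_orbitLInfty_apply [MeasurableMul G] [SFinite μ] [SFinite m] [SMulInvariantMeasure G G m]
    (hα : IsNearAction μ α) (h : G) :
    ∀ᵐ x ∂μ, hα.orbitLInfty m hf hf₁ (α h x) =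
      DomMulAct.mk h⁻¹ • hα.orbitLInfty m hf hf₁ x := by
  filter_upwards [hα.ae_ae_orbit_eq m hf h] with x hx
  rw [orbitLInfty, orbitLInfty, DomMulAct.mk_smul_toLp, MemLp.toLp_eq_toLp_iff]
  exact hx

/-- The maps `α g` need not be injective: `x` is recovered from `α g⁻¹ x` through the almost
everywhere identity `α g (α g⁻¹ x) = x`. -/
theorem exists_mem_ae_injOn_orbitLInfty [NeZero m] [MeasurableEq X] [SFinite μ] [SFinite m]
    (hα : IsNearAction μ α) (hinj : Function.Injective f) :
    ∃ s ∈ ae μ, Set.InjOn (hα.orbitLInfty m hf hf₁) s := by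
  refine ⟨_, hα.ae_ae_inv_right m, fun x hx y hy hxy => ?_⟩
  have hf_orbit : ∀ᵐ g ∂m, f (α g⁻¹ x) = f (α g⁻¹ y) :=
    (MemLp.toLp_eq_toLp_iff _ _).1 hxy
  obtain ⟨g, hg, hgx, hgy⟩ := (hf_orbit.and (Filter.Eventually.and hx hy)).exists
  rw [← hgx, hinj hg, hgy]

section OrbitFunctional

variable [SigmaFinite m] [NeZero m] {hf₀ : ∀ x, f x ≠ 0}

variable (m) in
/-- The functional `φ ↦ ∫ f (α g⁻¹ x) φ(g) dm(g)` on `L¹(m)` attached to the point `x`. -/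
noncomputable def orbitFunctional (hα : IsNearAction μ α) (hf : Measurable f)
    (hf₀ : ∀ x, f x ≠ 0) (hf₁ : ∀ x, ‖f x‖ ≤ 1) (x : X) : PuncturedDualBall 𝕜 (Lp 𝕜 1 m) :=
  .ofLInfty (hα.orbitLInfty m hf hf₁ x) (hα.norm_orbitLInfty_le x) (hα.orbitLInfty_ne_zero hf₀ x)

theorem orbitFunctional_apply (hα : IsNearAction μ α) (x : X) (φ : Lp 𝕜 1 m) :
    hα.orbitFunctional m hf hf₀ hf₁ x φ = ∫ g, f (α g⁻¹ x) * φ g ∂m := by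
  refine (integralDual_apply _ φ).trans (integral_congr_ae ?_)
  filter_upwards [hα.coeFn_orbitLInfty (hf := hf) (hf₁ := hf₁) x] with g hg
  rw [hg]

theorem measurable_orbitFunctional [IsSeparable m]
    [MeasurableSpace (PuncturedDualBall 𝕜 (Lp 𝕜 1 m))]
    [BorelSpace (PuncturedDualBall 𝕜 (Lp 𝕜 1 m))] (hα : IsNearAction μ α) :
    Measurable (hα.orbitFunctional m hf hf₀ hf₁) := by
  have : Fact ((1 : ℝ≥0∞) ≠ ∞) := ⟨ENNReal.one_ne_top⟩
  refine PuncturedDualBall.measurable_iff.2 fun φ => ?_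
  simp only [orbitFunctional_apply]
  exact hα.measurable_matrixCoefficient m hf (Lp.stronglyMeasurable φ).measurable

theorem integrable_orbitFunctional_apply [SFinite μ] (hα : IsNearAction μ α)
    (hfint : Integrable f μ) (φ : Lp 𝕜 1 m) :
    Integrable (fun x => hα.orbitFunctional m hf hf₀ hf₁ x φ) μ := by
  simp only [orbitFunctional_apply]
  exact hα.integrable_matrixCoefficient m hfint (L1.integrable_coeFn φ)

theorem isLocallyFiniteMeasure_map_orbitFunctional [IsSeparable m]
    [MeasurableSpace (PuncturedDualBall 𝕜 (Lp 𝕜 1 m))]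
    [BorelSpace (PuncturedDualBall 𝕜 (Lp 𝕜 1 m))] [SFinite μ] (hα : IsNearAction μ α)
    (hfint : Integrable f μ) :
    IsLocallyFiniteMeasure (μ.map (hα.orbitFunctional m hf hf₀ hf₁)) :=
  PuncturedDualBall.isLocallyFiniteMeasure_of_integrable fun φ =>
    (integrable_map_measure
      (PuncturedDualBall.continuous_apply φ).measurable.aestronglyMeasurable
      hα.measurable_orbitFunctional.aemeasurable).2
      (hα.integrable_orbitFunctional_apply hfint φ)

theorem ae_orbitFunctional_apply_eq_smul [MeasurableMul G] [SFinite μ] [SMulInvariantMeasure G G m]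
    (hα : IsNearAction μ α) (h : G) :
    ∀ᵐ x ∂μ, hα.orbitFunctional m hf hf₀ hf₁ (α h x) =
      h • hα.orbitFunctional m hf hf₀ hf₁ x := by
  filter_upwards [hα.ae_orbitLInfty_apply (m := m) (hf := hf) (hf₁ := hf₁) h] with x hx
  refine DFunLike.ext _ _ fun φ => ?_
  calc integralDual (hα.orbitLInfty m hf hf₁ (α h x)) φ
      = integralDual (DomMulAct.mk h⁻¹ • hα.orbitLInfty m hf hf₁ x)
          (DomMulAct.mk h⁻¹ • DomMulAct.mk h • φ) := by
        rw [hx, DomMulAct.mk_inv, inv_smul_smul]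
    _ = integralDual (hα.orbitLInfty m hf hf₁ x) (DomMulAct.mk h • φ) :=
        integralDual_smul_smul _ _ _

theorem exists_mem_ae_injOn_orbitFunctional [MeasurableEq X] [SFinite μ] (hα : IsNearAction μ α)
    (hinj : Function.Injective f) :
    ∃ s ∈ ae μ, Set.InjOn (hα.orbitFunctional m hf hf₀ hf₁) s := by
  obtain ⟨s, hs, hs_inj⟩ :=
    hα.exists_mem_ae_injOn_orbitLInfty (m := m) (hf := hf) (hf₁ := hf₁) hinj
  exact ⟨s, hs, fun x hx y hy hxy => hs_inj hx hy (PuncturedDualBall.ofLInfty_inj.1 hxy)⟩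

end OrbitFunctional
end IsNearAction

section Model

theorem measurePreserving_map_of_ae_semiconj {X Y : Type*} [MeasurableSpace X]
    [MeasurableSpace Y] {μ : Measure X} {Φ : X → Y} (hΦ : Measurable Φ) {S : X → X} {T : Y → Y}
    (hS : MeasurePreserving S μ μ) (hT : Measurable T) (h : ∀ᵐ x ∂μ, Φ (S x) = T (Φ x)) :
    MeasurePreserving T (μ.map Φ) (μ.map Φ) := by
  refine ⟨hT, ?_⟩
  calc (μ.map Φ).map T = μ.map (T ∘ Φ) := Measure.map_map hT hΦ
    _ = μ.map (Φ ∘ S) := Measure.map_congr (h.mono fun _ hx => hx.symm)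
    _ = (μ.map S).map Φ := (Measure.map_map hΦ hS.measurable).symm
    _ = μ.map Φ := by rw [hS.map_eq]

variable {G : Type v} {X Y : Type u} [MeasurableSpace X] [MeasurableSpace Y] {μ : Measure X}
  {α : G → X → X}

theorem booleanlyIsomorphic_map {β : G → Y → Y}
    (hα : ∀ g, Measure.QuasiMeasurePreserving (α g) μ μ) {Φ : X → Y} (hΦ : Measurable Φ)
    (hinj : ∃ s ∈ ae μ, Set.InjOn Φ s)
    (hequiv : ∀ g, ∀ᵐ x ∂μ, Φ (α g x) = β g (Φ x)) :
    BooleanlyIsomorphic μ (μ.map Φ) α β := by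
  obtain ⟨s, hs, hs_inj⟩ := hinj
  obtain ⟨X₀, hX₀, hX₀_meas, hX₀s⟩ :=
    Filter.IsMeasurablyGenerated.exists_measurable_subset hs
  refine ⟨X₀, fun x => Φ x, ?_⟩
  refine
    { measurableSet := hX₀_meas
      conull := hX₀
      injective := fun x y hxy => Subtype.ext (hs_inj (hX₀s x.2) (hX₀s y.2) hxy)
      measurePreserving := ?_
      equivariant := fun g => ?_ }
  · have hval := measurePreserving_subtype_coe (μa := μ) hX₀_meas
    rw [Measure.restrict_eq_self_of_ae_mem hX₀] at hval
    exact (hΦ.measurePreserving μ).comp hval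
  · obtain ⟨Xg, hXg, hXg_meas, h⟩ := Filter.Eventually.exists_measurable_mem
      (Filter.Eventually.and hX₀ (((hα g).ae hX₀).and (hequiv g)))
    exact ⟨Xg, fun x hx => (h x hx).1, hXg_meas, hXg,
      fun x hx => ⟨(h x hx).1, (h x hx).2.1, (h x hx).2.2⟩⟩

namespace IsBooleanIso

variable {ν : Measure Y} {β : G → Y → Y} {X₀ : Set X} {Φ : X₀ → Y}

theorem measure_image_preimage (h : IsBooleanIso μ ν α β X₀ Φ) {B : Set Y}
    (hB : MeasurableSet B) : μ (Subtype.val '' (Φ ⁻¹' B)) = ν B := by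
  rw [← h.measurePreserving.measure_preimage hB.nullMeasurableSet,
    comap_subtype_coe_apply h.measurableSet]

theorem nullSingletonClass [MeasurableSingletonClass Y] [NullSingletonClass μ]
    (h : IsBooleanIso μ ν α β X₀ Φ) : NullSingletonClass ν where
  measure_singleton y := by
    rw [← h.measure_image_preimage (measurableSet_singleton y)]
    exact ((Set.subsingleton_singleton.preimage h.injective).image _).measure_zero μ

theorem ne_zero (h : IsBooleanIso μ ν α β X₀ Φ) (hμ : μ ≠ 0) : ν ≠ 0 := by
  rintro rfl
  have hX₀ : μ X₀ = 0 := by simpa using h.measure_image_preimage .univ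
  refine hμ (Measure.measure_univ_eq_zero.1 ?_)
  rw [← Set.union_compl_self X₀, measure_union_null hX₀ h.conull]

end IsBooleanIso

theorem IsStandardSigmaFinite.of_booleanlyIsomorphic [StandardBorelSpace Y] {ν : Measure Y}
    [SigmaFinite ν] {β : G → Y → Y} (hμ : IsStandardSigmaFinite μ)
    (h : BooleanlyIsomorphic μ ν α β) : IsStandardSigmaFinite ν := by
  obtain ⟨X₀, Φ, hΦ⟩ := h
  have := hμ.atomless
  have hatomless := hΦ.nullSingletonClass
  have hne_zero := hΦ.ne_zero hμ.ne_zero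
  refine ⟨inferInstance, not_countable_iff.1 fun _ => ?_, inferInstance, hatomless, hne_zero⟩
  exact hne_zero (Measure.measure_univ_eq_zero.1 (Set.countable_univ.measure_zero ν))

/-- A continuous Radon model that need not be a standard `σ`-finite space: the measure `η` may have
atoms or vanish. -/
structure IsRadonModel [Group G] [TopologicalSpace G] (μ : Measure X) (α : G → X → X)
    (Y : Type u) [TopologicalSpace Y] [MeasurableSpace Y] [MulAction G Y] (η : Measure Y) :
    Prop where
  polish : PolishSpace Y
  locallyCompact : LocallyCompactSpace Y
  borel : BorelSpace Y
  radon : η.Regular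
  continuousSMul : ContinuousSMul G Y
  measurePreserving : ∀ g : G, MeasurePreserving (fun y : Y => g • y) η η
  iso : BooleanlyIsomorphic μ η α (fun (g : G) (y : Y) => g • y)

variable [Group G] [TopologicalSpace G]

theorem IsRadonModel.isContinuousRadonModel [TopologicalSpace Y] [MulAction G Y] {η : Measure Y}
    (h : IsRadonModel μ α Y η) (hμ : IsStandardSigmaFinite μ) :
    IsContinuousRadonModel μ α Y η := by
  have := h.polish
  have := h.locallyCompact
  have := h.borel
  have := h.radon
  exact { h with standard := hμ.of_booleanlyIsomorphic h.iso }

theorem isRadonModel_map [TopologicalSpace Y] [PolishSpace Y] [LocallyCompactSpace Y]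
    [BorelSpace Y] [MulAction G Y] [ContinuousSMul G Y]
    (hα : ∀ g, MeasurePreserving (α g) μ μ) {Φ : X → Y} (hΦ : Measurable Φ)
    [(μ.map Φ).Regular] (hinj : ∃ s ∈ ae μ, Set.InjOn Φ s)
    (hequiv : ∀ g, ∀ᵐ x ∂μ, Φ (α g x) = g • Φ x) :
    IsRadonModel μ α Y (μ.map Φ) where
  polish := inferInstance
  locallyCompact := inferInstance
  borel := inferInstance
  radon := inferInstance
  continuousSMul := inferInstance
  measurePreserving g := measurePreserving_map_of_ae_semiconj hΦ (hα g)
    (continuous_const_smul g).measurable (hequiv g)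
  iso := booleanlyIsomorphic_map (fun g => (hα g).quasiMeasurePreserving) hΦ hinj hequiv

theorem exists_isRadonModel_of_map {Z : Type*} [TopologicalSpace Z] [PolishSpace Z]
    [LocallyCompactSpace Z] [MeasurableSpace Z] [BorelSpace Z] [MulAction G Z]
    [ContinuousSMul G Z] (hα : ∀ g, MeasurePreserving (α g) μ μ) {Φ : X → Z} (hΦ : Measurable Φ)
    [IsLocallyFiniteMeasure (μ.map Φ)] (hinj : ∃ s ∈ ae μ, Set.InjOn Φ s)
    (hequiv : ∀ g, ∀ᵐ x ∂μ, Φ (α g x) = g • Φ x) :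
    ∃ (Y : Type u) (_ : TopologicalSpace Y) (_ : MeasurableSpace Y) (_ : MulAction G Y)
      (η : Measure Y), IsRadonModel μ α Y η := by
  have := small_of_standardBorelSpace.{u} Z
  borelize (Shrink.{u} Z)
  let e : Z ≃ₜ Shrink.{u} Z := Shrink.homeomorph Z
  have := polishSpace_shrink.{u} Z
  have := locallyCompactSpace_shrink.{u} Z
  have := continuousSMul_shrink.{u} Z G
  let := TopologicalSpace.upgradeIsCompletelyMetrizable Z
  have : (μ.map (e ∘ Φ)).Regular := by
    rw [← Measure.map_map e.continuous.measurable hΦ]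
    exact Measure.Regular.map e
  obtain ⟨s, hs, hs_inj⟩ := hinj
  refine ⟨Shrink.{u} Z, _, _, _, _, isRadonModel_map hα (e.continuous.measurable.comp hΦ)
    ⟨s, hs, e.injective.comp_injOn hs_inj⟩ fun g => ?_⟩
  filter_upwards [hequiv g] with x hx
  exact (congrArg e hx).trans (equivShrink_smul g (Φ x))

end Model

theorem mainTheorem7_general {G : Type v} [Group G] [TopologicalSpace G] [IsTopologicalGroup G]
    [SecondCountableTopology G] [LocallyCompactSpace G] [MeasurableSpace G] [BorelSpace G]
    {X : Type u} [MeasurableSpace X] [MeasurableSpace.CountablySeparated X] (μ : Measure X)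
    [SigmaFinite μ] (α : G → X → X) (hα : IsNearAction μ α) :
    ∃ (Y : Type u) (_ : TopologicalSpace Y) (_ : MeasurableSpace Y) (_ : MulAction G Y)
      (η : Measure Y), IsRadonModel μ α Y η := by
  obtain ⟨f, hf, hf_inj, hf_pos, hf_le, hf_int⟩ :=
    exists_measurable_injective_pos_le_one_integrable μ
  have hf₀ : ∀ x, f x ≠ 0 := fun x => (hf_pos x).ne'
  have hf₁ : ∀ x, ‖f x‖ ≤ 1 := fun x => (Real.norm_of_nonneg (hf_pos x).le).trans_le (hf_le x)
  have := measurableEq_of_countablySeparated X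
  have : Fact ((1 : ℝ≥0∞) ≠ ∞) := ⟨ENNReal.one_ne_top⟩
  let m : Measure G := Measure.haar
  borelize (PuncturedDualBall ℝ (Lp ℝ 1 m))
  let Φ : X → PuncturedDualBall ℝ (Lp ℝ 1 m) := hα.orbitFunctional m hf hf₀ hf₁
  have : IsLocallyFiniteMeasure (μ.map Φ) := hα.isLocallyFiniteMeasure_map_orbitFunctional hf_int
  exact exists_isRadonModel_of_map (Φ := Φ) hα.measurePreserving hα.measurable_orbitFunctional
    (hα.exists_mem_ae_injOn_orbitFunctional hf_inj) hα.ae_orbitFunctional_apply_eq_smul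

theorem mainTheorem7 {G : Type v} [Group G] [TopologicalSpace G] [IsTopologicalGroup G]
    [PolishSpace G] [LocallyCompactSpace G] [MeasurableSpace G] [BorelSpace G]
    {X : Type u} [MeasurableSpace X] (μ : Measure X) (hμ : IsStandardSigmaFinite μ)
    (α : G → X → X) (hα : IsBooleanAction μ α) :
    ∃ (Y : Type u) (_ : TopologicalSpace Y) (_ : MeasurableSpace Y) (_ : MulAction G Y)
      (η : Measure Y), IsContinuousRadonModel μ α Y η := by
  have := hμ.standardBorel
  have := hμ.sigmaFinite
  obtain ⟨Y, _, _, _, η, h⟩ := mainTheorem7_general μ α hα.isNearAction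
  exact ⟨Y, _, _, _, η, h.isContinuousRadonModel hμ⟩
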